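/- Let $K$ be an algebraically closed field of arbitrary characteristic. For distinct points $P_1,\dots,P_s\in\mathbb P^n=\mathbb P^n_K$ with defining homogeneous prime ideals $\wp_1,\dots,\wp_s\subset R=K[X_0,\dots,X_n]$ and positive integers $m_1,\dots,m_s$, the set of fat points $Z=m_1P_1+\cdots+m_sP_s$ is the zero-scheme defined by the ideal $I=\wp_1^{m_1}\cap\cdots\cap\wp_s^{m_s}$. Its Hilbert function is $H_Z(t)=\dim_K(R/I)_t$, and its regularity index $\operatorname{reg}(Z)$ is the least integer $t\ge 0$ such that $H_Z(t)=\sum_{i=1}^s\binom{m_i+n-1}{n}$. Let $\alpha\subseteq\mathbb P^n$ be an $r$-dimensional linear subspace containing $P_1,\dots,P_s$. Identify $\alpha$ with $\mathbb P^r$ by any linear isomorphism, let $P_{i\alpha}\in\mathbb P^r$ be the point corresponding to $P_i$, and let $Z_\alpha=m_1P_{1\alpha}+\cdots+m_sP_{s\alpha}$ be the resulting set of fat points in $\mathbb P^r$, with Hilbert function $H_{Z_\alpha}(t)=\dim_K(K[X_0,\dots,X_r]/I_\alpha)_t$, where $I_\alpha=\wp_{1\alpha}^{m_1}\cap\cdots\cap\wp_{s\alpha}^{m_s}$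 and $\wp_{i\alpha}\subset K[X_0,\dots,X_r]$ is the defining homogeneous prime ideal of $P_{i\alpha}$. Then $$H_{Z_\alpha}(t)\le H_Z(t)\qquad\text{for all } t\ge\operatorname{reg}(Z).$$ If moreover $m_i\ge 2$ for some $i$ and $r<n$, then $$H_{Z_\alpha}(t)<H_Z(t)\qquad\text{for all } t\ge\operatorname{reg}(Z).$$ -/

import Mathlib

open scoped LinearAlgebra.Projectivization

/-- The projective space `ℙⁿ` over `K`. -/
abbrev PSpace (K : Type*) [Field K] (n : ℕ) : Type _ := ℙ K (Fin (n + 1) → K)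

/-- The defining homogeneous ideal of a point `P` of `ℙⁿ` in `K[X₀, …, Xₙ]`: it is generated by
the homogeneous polynomials that vanish at (all homogeneous coordinate vectors of) `P`. -/
noncomputable def pointIdeal {K : Type*} [Field K] {n : ℕ} (P : PSpace K n) :
    Ideal (MvPolynomial (Fin (n + 1)) K) :=
  Ideal.span {f | (∃ d : ℕ, f.IsHomogeneous d) ∧
    ∀ (v : Fin (n + 1) → K) (hv : v ≠ 0), Projectivization.mk K v hv = P →
      MvPolynomial.eval v f = 0}

/-- Fat points `Z = m₁P₁ + ⋯ + mₛPₛ` in `ℙⁿ`: distinct points with positive multiplicities. -/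
structure FatPoints (K : Type*) [Field K] (n : ℕ) where
  /-- the number of points of the support -/
  s : ℕ
  /-- the points of the support -/
  point : Fin s → PSpace K n
  point_injective : Function.Injective point
  /-- the multiplicities -/
  mult : Fin s → ℕ
  mult_pos : ∀ i, 0 < mult i

namespace FatPoints

variable {K : Type*} [Field K] {n : ℕ}

/-- The homogeneous ideal `I = ℘₁^{m₁} ∩ ⋯ ∩ ℘ₛ^{mₛ}` of `Z`. -/
noncomputable def ideal (Z : FatPoints K n) : Ideal (MvPolynomial (Fin (n + 1)) K) :=
  ⨅ i, pointIdeal (Z.point i) ^ Z.mult i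

/-- The degree `t` part `(R/I)_t` of the homogeneous coordinate ring of `Z`, that is, the image
of the space of forms of degree `t` in `R/I`. -/
noncomputable def gradedPart (Z : FatPoints K n) (t : ℕ) :
    Submodule K (MvPolynomial (Fin (n + 1)) K ⧸ Z.ideal) :=
  (MvPolynomial.homogeneousSubmodule (Fin (n + 1)) K t).map
    (Ideal.Quotient.mkₐ K Z.ideal).toLinearMap

/-- The Hilbert function `H_Z(t) = dim_K (R/I)_t`. -/
noncomputable def hilbert (Z : FatPoints K n) (t : ℕ) : ℕ :=
  Module.finrank K (Z.gradedPart t)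

/-- The multiplicity `e(R/I) = ∑ᵢ binom(mᵢ + n - 1, n)`. -/
def multiplicity (Z : FatPoints K n) : ℕ :=
  ∑ i, (Z.mult i + n - 1).choose n

/-- The regularity index of `Z`: the least `t` with `H_Z(t) = e(R/I)`. -/
noncomputable def reg (Z : FatPoints K n) : ℕ :=
  sInf {t : ℕ | Z.hilbert t = Z.multiplicity}

end FatPoints

section Restrict

variable {K : Type*} [Field K] {n r : ℕ}

/-- The embedding `ℙʳ → ℙⁿ` with image `α` given by a linear identification `φ` of `K^{r+1}` with
the linear space underlying `α`. -/
def subspaceEmbedding (α : Projectivization.Subspace K (Fin (n + 1) → K))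
    (φ : (Fin (r + 1) → K) ≃ₗ[K] Projectivization.Subspace.submodule α) :
    PSpace K r → PSpace K n :=
  Projectivization.map ((Projectivization.Subspace.submodule α).subtype ∘ₗ φ.toLinearMap)
    (by
      rw [LinearMap.coe_comp]
      exact (Submodule.subtype_injective _).comp φ.injective)

theorem rep_mem_submodule {α : Projectivization.Subspace K (Fin (n + 1) → K)} {P : PSpace K n}
    (hP : P ∈ α) : P.rep ∈ Projectivization.Subspace.submodule α := by
  rw [Projectivization.Subspace.mem_submodule_iff _ P.rep_nonzero, P.mk_rep]
  exact hP

/-- A point `P` of `α`, regarded as a point `P_α` of `ℙʳ` through `φ`. -/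
noncomputable def pointIn (α : Projectivization.Subspace K (Fin (n + 1) → K))
    (φ : (Fin (r + 1) → K) ≃ₗ[K] Projectivization.Subspace.submodule α)
    (P : PSpace K n) (hP : P ∈ α) : PSpace K r :=
  Projectivization.mk K (φ.symm ⟨P.rep, rep_mem_submodule hP⟩) (by
    intro h
    rw [LinearEquiv.map_eq_zero_iff] at h
    exact P.rep_nonzero (congrArg Subtype.val h))

/-- `P_α` is the point of `ℙʳ` that the identification `ℙʳ ≅ α` takes to `P`. -/
theorem subspaceEmbedding_pointIn (α : Projectivization.Subspace K (Fin (n + 1) → K))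
    (φ : (Fin (r + 1) → K) ≃ₗ[K] Projectivization.Subspace.submodule α)
    (P : PSpace K n) (hP : P ∈ α) : subspaceEmbedding α φ (pointIn α φ P hP) = P := by
  unfold subspaceEmbedding pointIn
  rw [Projectivization.map_mk]
  simp only [LinearMap.comp_apply, LinearEquiv.coe_coe, LinearEquiv.apply_symm_apply,
    Submodule.subtype_apply]
  exact P.mk_rep

/-- The fat points `Z_α = m₁P_{1α} + ⋯ + mₛP_{sα}` in `ℙʳ ≅ α`, for `Z` supported in `α`. -/
noncomputable def FatPoints.inSubspace (Z : FatPoints K n)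
    (α : Projectivization.Subspace K (Fin (n + 1) → K))
    (φ : (Fin (r + 1) → K) ≃ₗ[K] Projectivization.Subspace.submodule α)
    (hZ : ∀ i, Z.point i ∈ α) : FatPoints K r where
  s := Z.s
  point i := pointIn α φ (Z.point i) (hZ i)
  point_injective i j h := by
    apply Z.point_injective
    have h' := congrArg (subspaceEmbedding α φ) h
    simpa only [subspaceEmbedding_pointIn] using h'
  mult := Z.mult
  mult_pos := Z.mult_pos

end Restrict

/-! Restricting forms from `K^{n+1}` to the linear space of `α` is surjective in each degree,
because an injective linear map has a left inverse, and it carries `Z.ideal` into the ideal of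
`Z_α`. So the degree `t` part for `Z` maps onto that for `Z_α`, and the weak inequality holds for
every `t` (`hilbert_inSubspace_le`).

For strictness in degree `t > 0`, multiply a linear form vanishing on `α` by the power `t - 1` of a
linear form not vanishing at a point `P` with multiplicity at least 2. The product dies on `α`, but
its order at `P` is exactly 1, so it is nonzero modulo `Z.ideal`
(`exists_form_vanishing_on_subspace`).

It remains to see that `reg` is positive. In degree 0 the Hilbert function is at most 1, while the
multiplicity exceeds 1. Since `sInf ∅ = 0`, it must also be shown that the multiplicity is attained
at all: the truncated Taylor expansions at the points identify `(R/I)_t` with the image of `jets`,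
which is surjective for `t = ∑ mᵢ` (`hilbert_sum_mult`). -/

open MvPolynomial

/-! ### Linear changes of variables -/

section LinearSubstitution

variable {K : Type*} [Field K] {a b : ℕ}

/-- The linear form attached to a linear functional on `Kᵃ`. -/
noncomputable def linForm (l : Module.Dual K (Fin a → K)) : MvPolynomial (Fin a) K :=
  ∑ j, C (l (Pi.single j 1)) * X j

theorem eval_linForm (l : Module.Dual K (Fin a → K)) (x : Fin a → K) :
    eval x (linForm l) = l x := by
  conv_rhs => rw [← Finset.univ_sum_single x, map_sum]
  simp only [linForm, map_sum, map_mul, eval_C, eval_X]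
  refine Finset.sum_congr rfl fun j _ => ?_
  rw [← mul_one (x j), ← smul_eq_mul (x j) 1, Pi.single_smul, map_smul, smul_eq_mul, smul_eq_mul,
    mul_one, mul_comm]

theorem isHomogeneous_linForm (l : Module.Dual K (Fin a → K)) : (linForm l).IsHomogeneous 1 :=
  IsHomogeneous.sum _ _ _ fun j _ => isHomogeneous_C_mul_X _ j

/-- The substitution `f ↦ f ∘ T` for a linear map `T : Kᵃ → Kᵇ`. -/
noncomputable def linSubst (T : (Fin a → K) →ₗ[K] (Fin b → K)) :
    MvPolynomial (Fin b) K →ₐ[K] MvPolynomial (Fin a) K :=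
  aeval fun k => linForm (LinearMap.proj k ∘ₗ T)

theorem linSubst_X (T : (Fin a → K) →ₗ[K] (Fin b → K)) (k : Fin b) :
    linSubst T (X k) = linForm (LinearMap.proj k ∘ₗ T) := aeval_X _ _

theorem eval_linSubst (T : (Fin a → K) →ₗ[K] (Fin b → K)) (x : Fin a → K)
    (f : MvPolynomial (Fin b) K) : eval x (linSubst T f) = eval (T x) f := by
  induction f using MvPolynomial.induction_on with
  | C c => simp [linSubst]
  | add p q hp hq => simp [hp, hq]
  | mul_X p k hp => simp [hp, linSubst_X, eval_linForm]

theorem isHomogeneous_linSubst (T : (Fin a → K) →ₗ[K] (Fin b → K)) {d : ℕ}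
    {f : MvPolynomial (Fin b) K} (hf : f.IsHomogeneous d) : (linSubst T f).IsHomogeneous d := by
  have h := hf.aeval (fun k => linForm (LinearMap.proj k ∘ₗ T)) fun k => isHomogeneous_linForm _
  rwa [one_mul] at h

/-- Over an infinite field polynomials are determined by their values, so identities can be checked
pointwise. -/
theorem linSubst_linSubst [Infinite K] {c : ℕ} (T : (Fin a → K) →ₗ[K] (Fin b → K))
    (S : (Fin b → K) →ₗ[K] (Fin c → K)) (f : MvPolynomial (Fin c) K) :
    linSubst T (linSubst S f) = linSubst (S ∘ₗ T) f :=
  MvPolynomial.funext fun x => by simp [eval_linSubst]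

theorem linSubst_id [Infinite K] (f : MvPolynomial (Fin a) K) : linSubst LinearMap.id f = f :=
  MvPolynomial.funext fun x => by simp [eval_linSubst]

end LinearSubstitution

/-! ### Order of vanishing at a point, in affine coordinates -/

section LocalExpansion

variable {K : Type*} [Field K] {n : ℕ}

/-- Dehomogenization with respect to the zeroth variable. -/
noncomputable def dehomogenize :
    MvPolynomial (Fin (n + 1)) K →ₐ[K] MvPolynomial (Fin n) K :=
  aeval (Fin.cons 1 X : Fin (n + 1) → MvPolynomial (Fin n) K)

theorem eval_dehomogenize (y : Fin n → K) (f : MvPolynomial (Fin (n + 1)) K) :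
    eval y (dehomogenize f) = eval (Fin.cons 1 y : Fin (n + 1) → K) f := by
  induction f using MvPolynomial.induction_on with
  | C c => simp [dehomogenize]
  | add p q hp hq => simp [hp, hq]
  | mul_X p k hp =>
    refine Fin.cases ?_ (fun k => ?_) k <;> simp [hp] <;> simp [dehomogenize]

theorem dehomogenize_monomial (s : Fin (n + 1) →₀ ℕ) (c : K) :
    dehomogenize (monomial s c) = monomial s.tail c := by
  rw [dehomogenize, aeval_monomial, Finsupp.prod_fintype _ _ (by simp), Fin.prod_univ_succ,
    monomial_eq (s := s.tail), Finsupp.prod_fintype _ _ (by simp)]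
  simp [Finsupp.tail_apply]

/-- The degree and the other exponents determine the exponent of `X 0`, so distinct monomials of a
form stay distinct. -/
theorem coeff_tail_dehomogenize {t : ℕ} {f : MvPolynomial (Fin (n + 1)) K}
    (hf : f.IsHomogeneous t) {s : Fin (n + 1) →₀ ℕ} (hs : s.degree = t) :
    coeff s.tail (dehomogenize f) = coeff s f := by
  classical
  conv_lhs => rw [f.as_sum, map_sum, coeff_sum]
  simp_rw [dehomogenize_monomial, coeff_monomial]
  have key : ∀ x ∈ f.support, x.tail = s.tail → x = s := fun x hx h => by
    have hd : x.degree = t := by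
      by_contra hne
      exact (mem_support_iff.mp hx) (hf.coeff_eq_zero hne)
    rw [← hs, Finsupp.degree_eq_sum, Finsupp.degree_eq_sum, Fin.sum_univ_succ,
      Fin.sum_univ_succ] at hd
    have h' : ∀ i : Fin n, x i.succ = s i.succ := fun i => by
      simpa [Finsupp.tail_apply] using DFunLike.congr_fun h i
    ext i
    refine Fin.cases ?_ h' i
    simpa [h'] using hd
  rw [Finset.sum_eq_single s]
  · simp
  · intro x hx hne
    rw [if_neg fun h => hne (key x hx h)]
  · intro h
    simpa using h

/-- The expansion of a form around the point `B e₀`, in the affine coordinates given by `B`. -/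
noncomputable def localExp (B : (Fin (n + 1) → K) →ₗ[K] (Fin (n + 1) → K)) :
    MvPolynomial (Fin (n + 1)) K →ₐ[K] MvPolynomial (Fin n) K :=
  dehomogenize.comp (linSubst B)

theorem eval_localExp (B : (Fin (n + 1) → K) →ₗ[K] (Fin (n + 1) → K)) (y : Fin n → K)
    (f : MvPolynomial (Fin (n + 1)) K) :
    eval y (localExp B f) = eval (B (Fin.cons 1 y)) f := by
  simp [localExp, eval_dehomogenize, eval_linSubst]

theorem mem_idealOfVars_iff_eval_zero {f : MvPolynomial (Fin n) K} :
    f ∈ idealOfVars (Fin n) K ↔ eval 0 f = 0 := by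
  rw [← pow_one (idealOfVars (Fin n) K), mem_pow_idealOfVars_iff', eval_zero,
    constantCoeff_eq]
  simp [Finsupp.degree_eq_zero_iff]

theorem cons_one_zero : (Fin.cons 1 0 : Fin (n + 1) → K) = Pi.single 0 1 := by
  ext i
  refine Fin.cases ?_ (fun i => ?_) i <;> simp

theorem localExp_mem_pow {B : (Fin (n + 1) → K) →ₗ[K] (Fin (n + 1) → K)} {P : PSpace K n}
    (hB : B (Pi.single 0 1) = P.rep) {m : ℕ} {f : MvPolynomial (Fin (n + 1)) K}
    (hf : f ∈ pointIdeal P ^ m) : localExp B f ∈ idealOfVars (Fin n) K ^ m := by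
  have h : (pointIdeal P).map (localExp B) ≤ idealOfVars (Fin n) K := by
    rw [pointIdeal, Ideal.map_span, Ideal.span_le]
    rintro _ ⟨g, ⟨-, hg⟩, rfl⟩
    rw [SetLike.mem_coe, mem_idealOfVars_iff_eval_zero, eval_localExp, cons_one_zero, hB]
    exact hg _ P.rep_nonzero P.mk_rep
  have := Ideal.mem_map_of_mem (localExp B) hf
  rw [Ideal.map_pow] at this
  exact Ideal.pow_right_mono h m this

theorem linForm_mem_pointIdeal {P : PSpace K n} {l : Module.Dual K (Fin (n + 1) → K)}
    (h : l P.rep = 0) : linForm l ∈ pointIdeal P := by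
  refine Ideal.subset_span ⟨⟨1, isHomogeneous_linForm l⟩, fun v hv hvP => ?_⟩
  subst hvP
  obtain ⟨a, ha⟩ := Projectivization.exists_smul_eq_mk_rep K v hv
  rw [← ha, Units.smul_def, map_smul, smul_eq_mul] at h
  rw [eval_linForm]
  exact (mul_eq_zero.mp h).resolve_left a.ne_zero

/-- In coordinates where `P` is `e₀`, every monomial of the form has degree at least `m` in the
variables other than `X 0`, and these are linear forms vanishing at `P`. -/
theorem mem_pow_of_localExp_mem_pow [Infinite K]
    {B : (Fin (n + 1) → K) ≃ₗ[K] (Fin (n + 1) → K)} {P : PSpace K n}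
    (hB : B (Pi.single 0 1) = P.rep) {m t : ℕ} {f : MvPolynomial (Fin (n + 1)) K}
    (hf : f.IsHomogeneous t) (h : localExp B.toLinearMap f ∈ idealOfVars (Fin n) K ^ m) :
    f ∈ pointIdeal P ^ m := by
  set g := linSubst B.toLinearMap f with hg
  have hgt : g.IsHomogeneous t := isHomogeneous_linSubst _ hf
  have hfg : f = linSubst B.symm.toLinearMap g := by
    rw [hg, linSubst_linSubst]
    simp [linSubst_id]
  rw [hfg, g.as_sum, map_sum]
  refine Ideal.sum_mem _ fun s hs => ?_
  have hd : s.degree = t := by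
    by_contra hne
    exact (mem_support_iff.mp hs) (hgt.coeff_eq_zero hne)
  have hm : m ≤ s.tail.degree := by
    by_contra! hlt
    have := (mem_pow_idealOfVars_iff' _ _).mp h _ hlt
    rw [show localExp B.toLinearMap f = dehomogenize g from rfl,
      coeff_tail_dehomogenize hgt hd] at this
    exact mem_support_iff.mp hs this
  have hX : ∀ j : Fin n, linSubst B.symm.toLinearMap (X j.succ : MvPolynomial (Fin (n + 1)) K) ∈
      pointIdeal P := fun j => by
    rw [linSubst_X]
    refine linForm_mem_pointIdeal ?_
    rw [← hB]
    simp
  rw [monomial_eq, Finsupp.prod_fintype _ _ (by simp), Fin.prod_univ_succ, map_mul, map_mul,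
    map_prod]
  refine Ideal.mul_mem_left _ _ (Ideal.mul_mem_left _ _ ?_)
  refine Ideal.pow_le_pow_right hm ?_
  rw [Finsupp.degree_eq_sum, ← Finset.prod_pow_eq_pow_sum]
  refine Ideal.prod_mem_prod fun j _ => ?_
  rw [map_pow]
  exact Ideal.pow_mem_pow (hX j) _

theorem exists_linearEquiv_single {v : Fin (n + 1) → K} (hv : v ≠ 0) :
    ∃ B : (Fin (n + 1) → K) ≃ₗ[K] (Fin (n + 1) → K), B (Pi.single 0 1) = v := by
  obtain ⟨k, hk⟩ := Function.ne_iff.mp hv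
  -- `C` sends the `k`-th basis vector to `v` and fixes the others; it is injective as `v k ≠ 0`.
  -- Swapping `0` and `k` first then gives `B`.
  let C : (Fin (n + 1) → K) →ₗ[K] (Fin (n + 1) → K) :=
    LinearMap.id + (LinearMap.proj k).smulRight (v - Pi.single k 1)
  have hC : ∀ x, C x = x + x k • (v - Pi.single k 1) := fun x => rfl
  have hinj : Function.Injective C := by
    rw [← LinearMap.ker_eq_bot, LinearMap.ker_eq_bot']
    intro x hx
    rw [hC] at hx
    have hxk : x k = 0 := by
      have := congrFun hx k
      simp only [Pi.add_apply, Pi.smul_apply, Pi.sub_apply, Pi.single_eq_same, smul_eq_mul,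
        Pi.zero_apply] at this
      have h2 : x k * v k = 0 := by linear_combination this
      exact (mul_eq_zero.mp h2).resolve_right hk
    simpa [hxk] using hx
  refine ⟨(LinearEquiv.funCongrLeft K K (Equiv.swap 0 k)).trans
    (LinearEquiv.ofInjectiveEndo C hinj), ?_⟩
  have hs : LinearEquiv.funCongrLeft K K (Equiv.swap 0 k) (Pi.single 0 1) =
      (Pi.single k 1 : Fin (n + 1) → K) := by
    ext i
    simp only [LinearEquiv.funCongrLeft_apply, LinearMap.funLeft_apply, Pi.single_apply]
    simp [Equiv.swap_apply_eq_iff]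
  rw [LinearEquiv.trans_apply, hs, LinearEquiv.coe_ofInjectiveEndo, hC]
  simp

end LocalExpansion

/-! ### Truncated power series and separation of points -/

section Truncation

variable {K : Type*} [Field K] {n : ℕ}

/-- The exponents of the monomials of degree less than `m` in `n` variables. -/
noncomputable def exponentsLT (n m : ℕ) : Finset (Fin n →₀ ℕ) :=
  (Finset.range m).biUnion fun k => Finset.univ.finsuppAntidiag k

theorem mem_exponentsLT {m : ℕ} {a : Fin n →₀ ℕ} : a ∈ exponentsLT n m ↔ a.degree < m := by
  simp [exponentsLT, Finset.mem_finsuppAntidiag, Finsupp.degree_eq_sum]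

theorem card_exponentsLT (n : ℕ) {m : ℕ} (hm : 0 < m) :
    (exponentsLT n m).card = (m + n - 1).choose n := by
  obtain ⟨m, rfl⟩ := Nat.exists_eq_add_one.mpr hm
  rw [exponentsLT, Finset.card_biUnion]
  · simp_rw [Finset.card_finsuppAntidiag_nat_eq_multichoose, Finset.card_univ, Fintype.card_fin,
      Nat.sum_range_multichoose]
    congr 1
    omega
  · intro i _ j _ hij
    rw [Function.onFun, Finset.disjoint_left]
    intro a ha hb
    rw [Finset.mem_finsuppAntidiag] at ha hb
    exact hij (ha.1.symm.trans hb.1)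

/-- The coefficients of a polynomial in degrees less than `m`. -/
noncomputable def truncation (m : ℕ) :
    MvPolynomial (Fin n) K →ₗ[K] (exponentsLT n m → K) :=
  LinearMap.pi fun a => lcoeff K a.1

theorem truncation_eq_zero_iff {m : ℕ} {p : MvPolynomial (Fin n) K} :
    truncation m p = 0 ↔ p ∈ idealOfVars (Fin n) K ^ m := by
  rw [mem_pow_idealOfVars_iff', funext_iff]
  exact ⟨fun h x hx => h ⟨x, mem_exponentsLT.mpr hx⟩, fun h x => h _ (mem_exponentsLT.mp x.2)⟩

theorem truncation_surjective (m : ℕ) :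
    Function.Surjective (truncation m : MvPolynomial (Fin n) K →ₗ[K] _) := by
  classical
  intro y
  refine ⟨∑ a, monomial a.1 (y a), funext fun b => ?_⟩
  change coeff b.1 (∑ a, monomial a.1 (y a)) = y b
  simp [coeff_sum, coeff_monomial, Subtype.ext_iff.symm]

/-- Geometric series: `p` is a nonzero constant times `1 - h`, with `h` vanishing at the origin. -/
theorem exists_mul_sub_one_mem_pow {p : MvPolynomial (Fin n) K} (hp : eval 0 p ≠ 0) (m : ℕ) :
    ∃ u, p * u - 1 ∈ idealOfVars (Fin n) K ^ m := by
  set h := 1 - C (eval 0 p)⁻¹ * p with hh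
  have hmem : h ∈ idealOfVars (Fin n) K := by
    rw [mem_idealOfVars_iff_eval_zero, hh, map_sub, map_mul, eval_C, inv_mul_cancel₀ hp, map_one,
      sub_self]
  obtain ⟨w, hw⟩ := sub_dvd_pow_sub_pow 1 h m
  refine ⟨C (eval 0 p)⁻¹ * w, ?_⟩
  have : p * (C (eval 0 p)⁻¹ * w) - 1 = -h ^ m := by
    rw [one_pow] at hw
    linear_combination -hw + w * hh
  rw [this]
  exact neg_mem (Ideal.pow_mem_pow hmem m)

/-- Only terms of degree at most `m - 1 ≤ d` matter, and each is homogenized by a power of `X 0`. -/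
theorem exists_dehomogenize_sub_mem {m d : ℕ} (hd : m ≤ d + 1) (q : MvPolynomial (Fin n) K) :
    ∃ F : MvPolynomial (Fin (n + 1)) K, F.IsHomogeneous d ∧
      dehomogenize F - q ∈ idealOfVars (Fin n) K ^ m := by
  induction q using MvPolynomial.induction_on' with
  | monomial s c =>
    by_cases hs : s.degree < m
    · refine ⟨monomial (Finsupp.cons (d - s.degree) s) c, isHomogeneous_monomial _ ?_, ?_⟩
      · rw [Finsupp.degree_eq_sum, Fin.sum_univ_succ]
        simp only [Finsupp.cons_zero, Finsupp.cons_succ, ← Finsupp.degree_eq_sum]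
        omega
      · simp [dehomogenize_monomial]
    · refine ⟨0, isHomogeneous_zero _ _ _, ?_⟩
      rw [map_zero, zero_sub]
      refine neg_mem ((mem_pow_idealOfVars_iff' _ _).mpr fun x hx => ?_)
      rw [coeff_monomial, if_neg]
      rintro rfl
      exact hs hx
  | add p q hp hq =>
    obtain ⟨F, hF, hFp⟩ := hp
    obtain ⟨G, hG, hGq⟩ := hq
    refine ⟨F + G, hF.add hG, ?_⟩
    rw [map_add, add_sub_add_comm]
    exact add_mem hFp hGq

theorem exists_localExp_sub_mem [Infinite K] (B : (Fin (n + 1) → K) ≃ₗ[K] (Fin (n + 1) → K))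
    {m d : ℕ} (hd : m ≤ d + 1) (q : MvPolynomial (Fin n) K) :
    ∃ F : MvPolynomial (Fin (n + 1)) K, F.IsHomogeneous d ∧
      localExp B.toLinearMap F - q ∈ idealOfVars (Fin n) K ^ m := by
  obtain ⟨F, hF, h⟩ := exists_dehomogenize_sub_mem hd q
  refine ⟨linSubst B.symm.toLinearMap F, isHomogeneous_linSubst _ hF, ?_⟩
  rwa [localExp, AlgHom.comp_apply, linSubst_linSubst, LinearEquiv.comp_coe,
    LinearEquiv.self_trans_symm, LinearEquiv.refl_toLinearMap, linSubst_id]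

theorem exists_dual_separating {P Q : PSpace K n} (h : P ≠ Q) :
    ∃ l : Module.Dual K (Fin (n + 1) → K), l P.rep ≠ 0 ∧ l Q.rep = 0 := by
  have hP : P.rep ∉ Submodule.span K {Q.rep} := by
    rw [Submodule.mem_span_singleton]
    rintro ⟨a, ha⟩
    apply h
    rw [← P.mk_rep, ← Q.mk_rep, Projectivization.mk_eq_mk_iff']
    exact ⟨a, ha⟩
  obtain ⟨l, hl, hle⟩ := Submodule.exists_le_ker_of_notMem hP
  exact ⟨l, hl, hle (Submodule.mem_span_singleton_self _)⟩

end Truncation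

/-! ### The multiplicity is attained by the Hilbert function -/

namespace FatPoints

variable {K : Type*} [Field K] {n : ℕ} (Z : FatPoints K n)

theorem exists_form_separating (i : Fin Z.s) :
    ∃ G : MvPolynomial (Fin (n + 1)) K, G.IsHomogeneous (∑ j ∈ Finset.univ.erase i, Z.mult j) ∧
      eval (Z.point i).rep G ≠ 0 ∧ ∀ j ≠ i, G ∈ pointIdeal (Z.point j) ^ Z.mult j := by
  have h : ∀ j, ∃ l : Module.Dual K (Fin (n + 1) → K), j ≠ i →
      l (Z.point i).rep ≠ 0 ∧ l (Z.point j).rep = 0 := fun j => by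
    by_cases hj : j = i
    · exact ⟨0, fun h => (h hj).elim⟩
    · obtain ⟨l, hl⟩ := exists_dual_separating (Z.point_injective.ne (Ne.symm hj))
      exact ⟨l, fun _ => hl⟩
  choose l hl using h
  refine ⟨∏ j ∈ Finset.univ.erase i, linForm (l j) ^ Z.mult j, ?_, ?_, ?_⟩
  · refine IsHomogeneous.prod _ _ _ fun j _ => ?_
    simpa using (isHomogeneous_linForm (l j)).pow (Z.mult j)
  · rw [map_prod, Finset.prod_ne_zero_iff]
    intro j hj
    rw [map_pow, eval_linForm]
    exact pow_ne_zero _ (hl j (Finset.ne_of_mem_erase hj)).1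
  · intro j hj
    rw [← Finset.mul_prod_erase _ _ (Finset.mem_erase.mpr ⟨hj, Finset.mem_univ j⟩)]
    exact Ideal.mul_mem_right _ _ (Ideal.pow_mem_pow (linForm_mem_pointIdeal (hl j hj).2) _)

theorem exists_form_localExp_sub_mem [Infinite K] (i : Fin Z.s)
    {B : (Fin (n + 1) → K) ≃ₗ[K] (Fin (n + 1) → K)} (hB : B (Pi.single 0 1) = (Z.point i).rep)
    (q : MvPolynomial (Fin n) K) :
    ∃ F : MvPolynomial (Fin (n + 1)) K, F.IsHomogeneous (∑ j, Z.mult j) ∧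
      localExp B.toLinearMap F - q ∈ idealOfVars (Fin n) K ^ Z.mult i ∧
      ∀ j ≠ i, F ∈ pointIdeal (Z.point j) ^ Z.mult j := by
  obtain ⟨G, hG, hGi, hGj⟩ := Z.exists_form_separating i
  have hu : eval 0 (localExp B.toLinearMap G) ≠ 0 := by
    rw [eval_localExp, cons_one_zero]
    simpa [hB] using hGi
  obtain ⟨u, hu⟩ := exists_mul_sub_one_mem_pow hu (Z.mult i)
  -- Multiplying by `G` secures vanishing at the other points; `F` is chosen near `u * q` to cancel
  -- the effect of `G` at point `i`.
  obtain ⟨F, hF, hFq⟩ := exists_localExp_sub_mem B (Nat.le_succ (Z.mult i)) (u * q)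
  refine ⟨F * G, ?_, ?_, fun j hj => Ideal.mul_mem_left _ _ (hGj j hj)⟩
  · rw [← Finset.add_sum_erase _ _ (Finset.mem_univ i)]
    exact hF.mul hG
  · have : localExp B.toLinearMap (F * G) - q =
        localExp B.toLinearMap G * (localExp B.toLinearMap F - u * q) +
          q * (localExp B.toLinearMap G * u - 1) := by
      rw [map_mul]
      ring
    rw [this]
    exact add_mem (Ideal.mul_mem_left _ _ hFq) (Ideal.mul_mem_left _ _ hu)

/-- The truncated expansions of the forms of degree `t` at the points of `Z`. -/
noncomputable def jets (B : Fin Z.s → ((Fin (n + 1) → K) ≃ₗ[K] (Fin (n + 1) → K))) (t : ℕ) :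
    homogeneousSubmodule (Fin (n + 1)) K t →ₗ[K] ((i : Fin Z.s) → exponentsLT n (Z.mult i) → K) :=
  LinearMap.pi fun i => truncation (Z.mult i) ∘ₗ (localExp (B i).toLinearMap).toLinearMap ∘ₗ
    (homogeneousSubmodule (Fin (n + 1)) K t).subtype

variable {Z} {B : Fin Z.s → ((Fin (n + 1) → K) ≃ₗ[K] (Fin (n + 1) → K))}

theorem ker_jets [Infinite K] (hB : ∀ i, B i (Pi.single 0 1) = (Z.point i).rep) (t : ℕ) :
    LinearMap.ker (Z.jets B t) = LinearMap.ker ((Ideal.Quotient.mkₐ K Z.ideal).toLinearMap ∘ₗ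
      (homogeneousSubmodule (Fin (n + 1)) K t).subtype) := by
  ext ⟨f, hf⟩
  have h1 : (Ideal.Quotient.mkₐ K Z.ideal).toLinearMap f = 0 ↔ f ∈ Z.ideal :=
    Ideal.Quotient.eq_zero_iff_mem
  rw [LinearMap.mem_ker, LinearMap.mem_ker, LinearMap.comp_apply, Submodule.subtype_apply, h1,
    FatPoints.ideal, Ideal.mem_iInf, funext_iff]
  refine forall_congr' fun i => ?_
  refine truncation_eq_zero_iff.trans ⟨fun h => ?_, fun h => ?_⟩
  · exact mem_pow_of_localExp_mem_pow (hB i) hf h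
  · exact localExp_mem_pow (hB i) h

theorem jets_surjective [Infinite K] (hB : ∀ i, B i (Pi.single 0 1) = (Z.point i).rep) :
    Function.Surjective (Z.jets B (∑ j, Z.mult j)) := by
  intro y
  choose q hq using fun i => truncation_surjective (Z.mult i) (y i)
  choose F hF hFi hFj using fun i => Z.exists_form_localExp_sub_mem i (hB i) (q i)
  refine ⟨∑ i, ⟨F i, hF i⟩, funext fun i => ?_⟩
  have h : ∀ k, Z.jets B (∑ j, Z.mult j) ⟨F k, hF k⟩ i = if k = i then y i else 0 := fun k => by
    change truncation (Z.mult i) (localExp (B i).toLinearMap (F k)) = _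
    split_ifs with hk
    · subst hk
      rw [← hq, ← sub_eq_zero, ← map_sub]
      exact truncation_eq_zero_iff.mpr (hFi k)
    · exact truncation_eq_zero_iff.mpr (localExp_mem_pow (hB i) (hFj k i (Ne.symm hk)))
  rw [map_sum, Finset.sum_apply]
  simp [h]

variable (Z) in
theorem gradedPart_eq_range (t : ℕ) :
    Z.gradedPart t = LinearMap.range ((Ideal.Quotient.mkₐ K Z.ideal).toLinearMap ∘ₗ
      (homogeneousSubmodule (Fin (n + 1)) K t).subtype) := by
  rw [LinearMap.range_comp, Submodule.range_subtype, gradedPart]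

variable (Z) in
theorem hilbert_sum_mult [Infinite K] : Z.hilbert (∑ j, Z.mult j) = Z.multiplicity := by
  choose B hB using fun i => exists_linearEquiv_single (Z.point i).rep_nonzero
  rw [hilbert, gradedPart_eq_range, ← (LinearMap.quotKerEquivRange _).finrank_eq, ← ker_jets hB,
    (LinearMap.quotKerEquivOfSurjective _ (jets_surjective hB)).finrank_eq,
    Module.finrank_pi_fintype, multiplicity]
  simp [card_exponentsLT n (Z.mult_pos _)]

variable (Z) in
theorem hilbert_reg [Infinite K] : Z.hilbert Z.reg = Z.multiplicity :=
  Nat.sInf_mem (s := {t : ℕ | Z.hilbert t = Z.multiplicity}) ⟨_, Z.hilbert_sum_mult⟩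

end FatPoints

/-! ### Positivity of the regularity index, and restriction to `α` -/

namespace FatPoints

variable {K : Type*} [Field K] {n r : ℕ}

instance finite_gradedPart (Z : FatPoints K n) (t : ℕ) : Module.Finite K (Z.gradedPart t) :=
  Module.Finite.iff_fg.mpr ((homogeneousSubmodule_fg _ _ t).map _)

theorem hilbert_zero_le_one (Z : FatPoints K n) : Z.hilbert 0 ≤ 1 := by
  have h : Z.gradedPart 0 = Submodule.span K {Ideal.Quotient.mkₐ K Z.ideal 1} := by
    rw [gradedPart, homogeneousSubmodule_zero, Submodule.one_eq_span, Submodule.map_span,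
      Set.image_singleton]
    rfl
  rw [hilbert, h]
  exact (finrank_span_le_card _).trans (by simp)

theorem one_lt_multiplicity (Z : FatPoints K n) (hn : 0 < n) {i : Fin Z.s} (hi : 2 ≤ Z.mult i) :
    1 < Z.multiplicity := by
  have h1 : (n + 1).choose n ≤ (Z.mult i + n - 1).choose n := Nat.choose_le_choose n (by omega)
  have h2 : (Z.mult i + n - 1).choose n ≤ Z.multiplicity :=
    Finset.single_le_sum (f := fun i => (Z.mult i + n - 1).choose n) (fun _ _ => Nat.zero_le _)
      (Finset.mem_univ i)
  rw [Nat.choose_succ_self_right] at h1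
  omega

theorem reg_pos [Infinite K] (Z : FatPoints K n) (hn : 0 < n) {i : Fin Z.s}
    (hi : 2 ≤ Z.mult i) : 0 < Z.reg := by
  by_contra! h
  have h1 := Z.hilbert_reg
  rw [Nat.le_zero.mp h] at h1
  have h2 := Z.one_lt_multiplicity hn hi
  have h3 := Z.hilbert_zero_le_one
  omega

section Restriction

variable (Z : FatPoints K n) {α : Projectivization.Subspace K (Fin (n + 1) → K)}
  {φ : (Fin (r + 1) → K) ≃ₗ[K] Projectivization.Subspace.submodule α}
  (hZ : ∀ i, Z.point i ∈ α)

variable (φ) in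
/-- The linear embedding `K^{r+1} → K^{n+1}` that underlies `subspaceEmbedding`. -/
def linearEmbedding : (Fin (r + 1) → K) →ₗ[K] (Fin (n + 1) → K) :=
  (Projectivization.Subspace.submodule α).subtype ∘ₗ φ.toLinearMap

theorem ker_linearEmbedding : LinearMap.ker (linearEmbedding φ) = ⊥ := by
  rw [LinearMap.ker_eq_bot, linearEmbedding, LinearMap.coe_comp]
  exact (Submodule.subtype_injective _).comp φ.injective

theorem linSubst_mem_pointIdeal {P : PSpace K n} (hP : P ∈ α) {f : MvPolynomial (Fin (n + 1)) K}
    (hf : f ∈ pointIdeal P) : linSubst (linearEmbedding φ) f ∈ pointIdeal (pointIn α φ P hP) := by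
  suffices h : pointIdeal P ≤ (pointIdeal (pointIn α φ P hP)).comap
      (linSubst (linearEmbedding φ)) from h hf
  refine Ideal.span_le.mpr ?_
  rintro g ⟨⟨d, hd⟩, hg⟩
  refine Ideal.subset_span ⟨⟨d, isHomogeneous_linSubst _ hd⟩, fun v hv hvP => ?_⟩
  rw [eval_linSubst]
  refine hg _ (fun h => hv (LinearMap.ker_eq_bot'.mp ker_linearEmbedding _ h)) ?_
  rw [← subspaceEmbedding_pointIn α φ P hP, ← hvP]
  rfl

theorem linSubst_mem_ideal {f : MvPolynomial (Fin (n + 1)) K} (hf : f ∈ Z.ideal) :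
    linSubst (linearEmbedding φ) f ∈ (Z.inSubspace α φ hZ).ideal := by
  rw [ideal, Ideal.mem_iInf] at hf ⊢
  intro i
  have hle : (pointIdeal (Z.point i)).map (linSubst (linearEmbedding φ)) ≤
      pointIdeal (pointIn α φ (Z.point i) (hZ i)) :=
    Ideal.map_le_iff_le_comap.mpr fun _ hg => linSubst_mem_pointIdeal (hZ i) hg
  have h := Ideal.mem_map_of_mem (linSubst (linearEmbedding φ)) (hf i)
  rw [Ideal.map_pow] at h
  exact Ideal.pow_right_mono hle _ h

/-- Restriction of homogeneous coordinate rings from `Z` to `Z_α`. -/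
noncomputable def restriction :
    (MvPolynomial (Fin (n + 1)) K ⧸ Z.ideal) →ₐ[K]
      (MvPolynomial (Fin (r + 1)) K ⧸ (Z.inSubspace α φ hZ).ideal) :=
  Ideal.quotientMapₐ _ (linSubst (linearEmbedding φ)) fun _ hf => Z.linSubst_mem_ideal hZ hf

theorem map_restriction_gradedPart [Infinite K] (t : ℕ) :
    (Z.gradedPart t).map (Z.restriction hZ (φ := φ)).toLinearMap =
      (Z.inSubspace α φ hZ).gradedPart t := by
  have h : (homogeneousSubmodule (Fin (n + 1)) K t).map
      (linSubst (linearEmbedding φ)).toLinearMap = homogeneousSubmodule (Fin (r + 1)) K t := by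
    refine le_antisymm (Submodule.map_le_iff_le_comap.mpr fun f hf =>
      isHomogeneous_linSubst _ hf) fun f hf => ?_
    obtain ⟨T, hT⟩ := (linearEmbedding φ).exists_leftInverse_of_injective ker_linearEmbedding
    refine ⟨linSubst T f, isHomogeneous_linSubst _ hf, ?_⟩
    rw [AlgHom.toLinearMap_apply, linSubst_linSubst, hT, linSubst_id]
  rw [gradedPart, gradedPart, ← h, ← Submodule.map_comp, ← Submodule.map_comp]
  rfl

theorem hilbert_inSubspace_le [Infinite K] (t : ℕ) :
    (Z.inSubspace α φ hZ).hilbert t ≤ Z.hilbert t := by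
  rw [hilbert, hilbert, ← Z.map_restriction_gradedPart hZ]
  exact Submodule.finrank_map_le _ _

/-- With equal finite dimensions the surjective restriction would be injective, yet it kills the
nonzero class of `f`. -/
theorem hilbert_inSubspace_lt [Infinite K] {t : ℕ} {f : MvPolynomial (Fin (n + 1)) K}
    (hft : f.IsHomogeneous t) (hf : f ∉ Z.ideal)
    (hfα : linSubst (linearEmbedding φ) f = 0) :
    (Z.inSubspace α φ hZ).hilbert t < Z.hilbert t := by
  refine lt_of_le_of_ne (Z.hilbert_inSubspace_le hZ t) fun heq => hf ?_
  let ρ : Z.gradedPart t →ₗ[K] (Z.inSubspace α φ hZ).gradedPart t :=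
    (Z.restriction hZ).toLinearMap.restrict fun x hx => by
      rw [← Z.map_restriction_gradedPart hZ]
      exact Submodule.mem_map_of_mem hx
  have hsurj : Function.Surjective ρ := by
    rintro ⟨y, hy⟩
    have hy' := hy
    rw [← Z.map_restriction_gradedPart hZ] at hy'
    obtain ⟨x, hx, hxy⟩ := hy'
    exact ⟨⟨x, hx⟩, Subtype.ext hxy⟩
  have hinj := (LinearMap.injective_iff_surjective_of_finrank_eq_finrank heq.symm).mpr hsurj
  let x : Z.gradedPart t := ⟨Ideal.Quotient.mkₐ K Z.ideal f, Submodule.mem_map_of_mem hft⟩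
  have hx : ρ x = ρ 0 := by
    rw [map_zero]
    refine Subtype.ext ?_
    change Ideal.Quotient.mk _ (linSubst (linearEmbedding φ) f) = 0
    rw [hfα, map_zero]
  exact Ideal.Quotient.eq_zero_iff_mem.mp (congrArg Subtype.val (hinj hx))

theorem exists_form_vanishing_on_subspace [Infinite K] {i : Fin Z.s} (hi : 2 ≤ Z.mult i)
    (hP : Z.point i ∈ α) (φ : (Fin (r + 1) → K) ≃ₗ[K] Projectivization.Subspace.submodule α)
    (hr : r < n) {t : ℕ} (ht : 0 < t) :
    ∃ f : MvPolynomial (Fin (n + 1)) K, f.IsHomogeneous t ∧ f ∉ Z.ideal ∧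
      linSubst (linearEmbedding φ) f = 0 := by
  have hα : Projectivization.Subspace.submodule α < ⊤ := by
    refine lt_top_iff_ne_top.mpr fun h => ?_
    have h' := φ.finrank_eq
    rw [h, finrank_top, Module.finrank_fin_fun, Module.finrank_fin_fun] at h'
    omega
  obtain ⟨l, hl, hlα⟩ := Submodule.exists_le_ker_of_lt_top _ hα
  obtain ⟨B, hB⟩ := exists_linearEquiv_single (Z.point i).rep_nonzero
  have hBl : localExp B.toLinearMap (linForm l) = ∑ j : Fin n,
      C (l (B (Pi.single j.succ 1))) * X j := MvPolynomial.funext fun y => by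
    have hy : (Fin.cons 1 y : Fin (n + 1) → K) =
        Pi.single 0 1 + ∑ j : Fin n, y j • Pi.single j.succ 1 := by
      ext k
      refine Fin.cases ?_ (fun k => ?_) k
      · simp
      · simp [Pi.single_apply]
    rw [eval_localExp, eval_linForm, hy]
    have h0 : l (Z.point i).rep = 0 := hlα (rep_mem_submodule hP)
    simp [hB, h0, mul_comm]
  -- The nonzero form `l` vanishes at `B e₀`, which is the point, so not at every other `B eⱼ`; this
  -- gives a nonzero linear term.
  obtain ⟨j, hj⟩ : ∃ j : Fin n, l (B (Pi.single j.succ 1)) ≠ 0 := by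
    by_contra! h
    apply hl
    suffices hz : l ∘ₗ B.toLinearMap = 0 by
      ext1 k
      have := LinearMap.congr_fun hz (B.symm (Pi.single k 1))
      ext
      simpa using this
    refine LinearMap.pi_ext' fun k => LinearMap.ext_ring ?_
    refine Fin.cases ?_ (fun k => ?_) k
    · simpa [hB] using hlα (rep_mem_submodule hP)
    · simpa using h k
  -- The second factor only raises the degree: its local expansion at the point is 1.
  refine ⟨linForm l * linSubst B.symm.toLinearMap (X 0) ^ (t - 1), ?_, fun hf => hj ?_, ?_⟩
  · have h := (isHomogeneous_linForm l).mul
      ((isHomogeneous_linSubst B.symm.toLinearMap (isHomogeneous_X K 0)).pow (t - 1))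
    rwa [one_mul, Nat.add_sub_cancel' ht] at h
  · rw [ideal, Ideal.mem_iInf] at hf
    have h := localExp_mem_pow (B := B.toLinearMap) hB (Ideal.pow_le_pow_right hi (hf i))
    have h0 : localExp B.toLinearMap (linSubst B.symm.toLinearMap (X 0)) = 1 :=
      MvPolynomial.funext fun y => by simp [eval_localExp, eval_linSubst]
    rw [map_mul, map_pow, h0, one_pow, mul_one, hBl, mem_pow_idealOfVars_iff'] at h
    have h1 := h (Finsupp.single j 1) (by simp)
    classical
    simpa [coeff_sum, coeff_C_mul, coeff_X, Finsupp.single_left_inj] using h1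
  · rw [map_mul]
    refine mul_eq_zero_of_left (MvPolynomial.funext fun y => ?_) _
    rw [eval_linSubst, eval_linForm, map_zero]
    exact hlα (φ y).2

end Restriction

end FatPoints

theorem corollary3p6 {K : Type*} [Field K] [IsAlgClosed K] {n r : ℕ} (Z : FatPoints K n)
    (α : Projectivization.Subspace K (Fin (n + 1) → K))
    (φ : (Fin (r + 1) → K) ≃ₗ[K] Projectivization.Subspace.submodule α)
    (hZ : ∀ i, Z.point i ∈ α) :
    (∀ t : ℕ, Z.reg ≤ t → (Z.inSubspace α φ hZ).hilbert t ≤ Z.hilbert t) ∧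
    ((∃ i, 2 ≤ Z.mult i) → r < n →
      ∀ t : ℕ, Z.reg ≤ t → (Z.inSubspace α φ hZ).hilbert t < Z.hilbert t) := by
  refine ⟨fun t _ => Z.hilbert_inSubspace_le hZ t, ?_⟩
  rintro ⟨i, hi⟩ hr t ht
  obtain ⟨f, hft, hf, hfα⟩ := Z.exists_form_vanishing_on_subspace hi (hZ i) φ hr
    ((Z.reg_pos (Nat.zero_lt_of_lt hr) hi).trans_le ht)
  exact Z.hilbert_inSubspace_lt hZ hft hf hfα
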